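/- For a function $f$ on $[0,1]$ let $D^jf$ denote its $j$-th derivative, one-sided at the endpoints; "increasing" is meant in the non-strict sense. For a nonnegative integer $n$ let \[ W_n=\{b=(b_0,\dots,b_n)\in\mathbb R^{n+1}:\ \text{there is } f\in C^n[0,1] \text{ with } D^nf \text{ increasing and nonconstant, } D^jf(0)=0,\ D^jf(1)=b_j\ (0\le j\le n)\}. \] Let $(P_n)$ be the statement that $W_n$ is open in $\mathbb R^{n+1}$ and that for each $b\in W_n$ the witnessing function $f$ may be chosen to be $C^\infty$ with $D^{n+1}f(x)>0$ for all $x\in(0,1)$, $D^{n+1}f(0)=D^{n+1}f(1)=1$ and $D^jf(0)=D^jf(1)=0$ for all $j>n+1$. **Theorem.** The statements $(P_n)$, $n=0,1,2,3$, all hold, and \begin{align*} W_0&=\{a\in\mathbb R:0<a\},\\ W_1&=\{(a,b)\in\mathbb R^2:0<a<b\},\\ W_2&=\{(a,b,c)\in\mathbb R^3:0<2a<b,\ b^2<2ac\},\\ W_3&=\{(a,b,c,d)\in\mathbb R^4:0<c<d,\ 2b^2<3ac,\ 6ad+4b^2+c^2<6ac+2bc+2bd\}. \end{align*} Moreover,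 for $n=0,1,2,3$, a point $b\in\mathbb R^{n+1}$ belongs to $W_n$ if and only if the following holds: for all real sequences $(\alpha_j)_{j\ge0}$ and $(\beta_j)_{j\ge0}$ such that $\alpha_j=0$ and $\beta_j=b_j$ for $j\le n$, such that the first nonzero $\alpha_j$ with $j>n$ (if there is one) is positive, and such that the first nonzero $\beta_j$ with $j>n$ (if there is one) satisfies $(-1)^{n+j+1}\beta_j>0$, there is an $f\in C^\infty[0,1]$ with $D^{n+1}f(x)>0$ for all $x\in(0,1)$ and with $D^jf(0)=\alpha_j$ and $D^jf(1)=\beta_j$ for all $j\ge0$. -/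

import Mathlib

open scoped ContDiff

namespace EndpointValues

/-- The derivative `D^j f(x)` of order `j` on the interval `[0,1]`, one-sided at the endpoints. -/
noncomputable def D (j : ℕ) (f : ℝ → ℝ) (x : ℝ) : ℝ :=
  iteratedDerivWithin j f (Set.Icc 0 1) x

/-- `f` (considered on `[0,1]` only) is `C^n`, and `D^n f` is increasing (in the non-strict sense)
but not constant on `[0,1]`. -/
def MemF (n : ℕ) (f : ℝ → ℝ) : Prop :=
  ContDiffOn ℝ n f (Set.Icc 0 1) ∧
  MonotoneOn (D n f) (Set.Icc 0 1) ∧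
  ∃ x ∈ Set.Icc (0 : ℝ) 1, ∃ y ∈ Set.Icc (0 : ℝ) 1, D n f x ≠ D n f y

/-- `f` (considered on `[0,1]` only) is `C^∞` and `D^(n+1) f > 0` on `(0,1)`. -/
def MemFInf (n : ℕ) (f : ℝ → ℝ) : Prop :=
  ContDiffOn ℝ ∞ f (Set.Icc 0 1) ∧ ∀ x ∈ Set.Ioo (0 : ℝ) 1, 0 < D (n + 1) f x

/-- `f` witnesses that `b = (b_0, …, b_n)` belongs to `W_n`. -/
def IsWitness (n : ℕ) (b : Fin (n + 1) → ℝ) (f : ℝ → ℝ) : Prop :=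
  MemF n f ∧ ∀ j : Fin (n + 1), D j f 0 = 0 ∧ D j f 1 = b j

/-- The set `W_n ⊆ ℝ^(n+1)`. -/
def W (n : ℕ) : Set (Fin (n + 1) → ℝ) :=
  {b | ∃ f : ℝ → ℝ, IsWitness n b f}

/-- The statement `(P_n)`: `W_n` is open, and each of its points has a `C^∞` witness `f` with
`D^(n+1) f > 0` on `(0,1)`, with `D^(n+1) f = 1` at both endpoints and with all higher
derivatives zero at both endpoints. -/
def P (n : ℕ) : Prop :=
  IsOpen (W n) ∧
  ∀ b ∈ W n, ∃ f : ℝ → ℝ, IsWitness n b f ∧ MemFInf n f ∧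
    D (n + 1) f 0 = 1 ∧ D (n + 1) f 1 = 1 ∧
    ∀ j, n + 1 < j → D j f 0 = 0 ∧ D j f 1 = 0

/-- Sequences `α` admissible as the derivatives at the left endpoint: `α_j = x_j` for `j ≤ n`, and
the first nonzero term `α_j` with `j > n`, if there is one, is positive. -/
def A (n : ℕ) (x : Fin (n + 1) → ℝ) : Set (ℕ → ℝ) :=
  {α | (∀ j : Fin (n + 1), α j = x j) ∧
    ∀ j, n < j → α j ≠ 0 → (∀ i, n < i → i < j → α i = 0) → 0 < α j}

/-- Sequences `β` admissible as the derivatives at the right endpoint: `β_j = x_j` for `j ≤ n`, and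
the first nonzero term `β_j` with `j > n`, if there is one, satisfies `(-1)^(n+j+1) β_j > 0`. -/
def B (n : ℕ) (x : Fin (n + 1) → ℝ) : Set (ℕ → ℝ) :=
  {β | (∀ j : Fin (n + 1), β j = x j) ∧
    ∀ j, n < j → β j ≠ 0 → (∀ i, n < i → i < j → β i = 0) → 0 < (-1) ^ (n + j + 1) * β j}

/-- The set `W_n^∞ ⊆ ℝ^(n+1)`: for all admissible endpoint sequences continuing `0` on the left and
`b` on the right there is a `C^∞` function on `[0,1]` with `D^(n+1) f > 0` on `(0,1)` having these
sequences as its derivatives at the endpoints. -/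
def WInf (n : ℕ) : Set (Fin (n + 1) → ℝ) :=
  {b | ∀ α ∈ A n 0, ∀ β ∈ B n b, ∃ f : ℝ → ℝ, MemFInf n f ∧
    ∀ j : ℕ, D j f 0 = α j ∧ D j f 1 = β j}

end EndpointValues

namespace EndpointValues

open Filter Topology Set MeasureTheory

/-! This is a truncated moment problem. If all derivatives up to order `n` vanish at `0`, Taylor's
formula at `1` gives `b_j = ∫ (1-t)^(n-j)/(n-j)! dμ(t)`, where `μ` is the Stieltjes measure of `D^n
f`: nonzero, atomless and supported in `(0,1]`.

Necessity of the inequalities: with `s = 1 - t`, a nonzero polynomial in `s` that is nonnegative on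
`[0,1]` has finitely many zeros, so its `μ`-integral is strictly positive
(`exists_moments_of_mem_W`). Squares, possibly multiplied by `s`, `1-s` or `s(1-s)`, yield every
stated inequality.

Sufficiency: fix admissible endpoint jets and let `V` be the set of moment vectors of smooth
densities `h = D^(n+1) f` that are positive on `(0,1)` and have these jets. `V` is convex. Its
closure contains `0` (`zero_mem_closure_moments_image`) and is stable under adding nonnegative
multiples of moment vectors of unit masses (`add_smul_diracMoments_mem_closure`), so it contains all
moment vectors of finite discrete measures. Each point of the explicit set `S` is such a vector.
Since `S` is open and `V` is convex and finite-dimensional, `S ⊆ closure V` forces `S ⊆ V`. Hence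
`W_n ⊆ S ⊆ W_n^∞ ⊆ W_n`, and all claims follow. -/

/-! ### Smooth functions with a prescribed jet at `0` -/

theorem exists_bound_iteratedDeriv_of_hasCompactSupport {g : ℝ → ℝ} (hg : ContDiff ℝ ∞ g)
    (hs : HasCompactSupport g) (k : ℕ) : ∃ C, ∀ x, |iteratedDeriv k g x| ≤ C := by
  obtain ⟨C, hC⟩ := (hs.iteratedFDeriv (𝕜 := ℝ) k).exists_bound_of_continuous
    (hg.continuous_iteratedFDeriv (m := k) (mod_cast le_top))
  refine ⟨C, fun x => ?_⟩
  have := hC x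
  rwa [norm_iteratedFDeriv_eq_norm_iteratedDeriv, Real.norm_eq_abs] at this

/-- **Borel's lemma**: every real sequence is the sequence of derivatives at `0` of a smooth
function. -/
theorem exists_contDiff_iteratedDeriv_zero_eq (a : ℕ → ℝ) :
    ∃ u : ℝ → ℝ, ContDiff ℝ ∞ u ∧ ∀ k, iteratedDeriv k u 0 = a k := by
  let χ : ContDiffBump (0 : ℝ) := ⟨1, 2, by norm_num, by norm_num⟩
  let g : ℕ → ℝ → ℝ := fun j x => x ^ j * χ x
  have hg : ∀ j, ContDiff ℝ ∞ (g j) := fun j => (contDiff_id.pow j).mul χ.contDiff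
  have hgs : ∀ j, HasCompactSupport (g j) := fun j => χ.hasCompactSupport.mul_left
  have hg0 : ∀ j k, iteratedDeriv k (g j) 0 = if k = j then (j.factorial : ℝ) else 0 := by
    intro j k
    have : g j =ᶠ[𝓝 0] fun x => x ^ j := by
      filter_upwards [χ.eventuallyEq_one] with x hx
      simp [g, hx]
    rw [this.iteratedDeriv_eq, iteratedDeriv_fun_pow_zero]
    split_ifs <;> simp_all
  choose C hC using fun j k => exists_bound_iteratedDeriv_of_hasCompactSupport (hg j) (hgs j) k
  have hC0 : ∀ j k, 0 ≤ C j k := fun j k => (abs_nonneg _).trans (hC j k 0)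
  -- The dilation factor `l j` is taken so large that, for every `k < j`, the `k`-th derivative of
  -- the `j`-th term is at most `2^(-j)`. The division by `j! * l j ^ j` in `c` restores the `j`-th
  -- derivative `a j` at `0`.
  let S : ℕ → ℝ := fun j => 2 ^ j * |a j| * ∑ k ∈ Finset.range j, C j k
  have hS0 : ∀ j, 0 ≤ S j := fun j =>
    mul_nonneg (by positivity) (Finset.sum_nonneg fun k _ => hC0 j k)
  let l : ℕ → ℝ := fun j => 1 + S j
  have hl1 : ∀ j, 1 ≤ l j := fun j => le_add_of_nonneg_right (hS0 j)
  have hl0 : ∀ j, 0 < l j := fun j => one_pos.trans_le (hl1 j)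
  let c : ℕ → ℝ := fun j => a j / (j.factorial * l j ^ j)
  let F : ℕ → ℝ → ℝ := fun j x => c j * g j (l j * x)
  have hF : ∀ j, ContDiff ℝ ∞ (F j) := fun j =>
    contDiff_const.mul ((hg j).comp (contDiff_const.mul contDiff_id))
  have hFd : ∀ j k x, iteratedDeriv k (F j) x = c j * (l j ^ k * iteratedDeriv k (g j) (l j * x)) := by
    intro j k x
    have h1 := iteratedDeriv_const_mul_field (n := k) (x := x) (c j) (fun y => g j (l j * y))
    rw [show iteratedDeriv k (F j) x = _ from h1,
      iteratedDeriv_comp_const_mul ((hg j).of_le (mod_cast le_top)) (l j)]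
  let v : ℕ → ℕ → ℝ := fun k j => |c j| * (l j ^ k * C j k)
  have hFv : ∀ k j x, ‖iteratedFDeriv ℝ k (F j) x‖ ≤ v k j := by
    intro k j x
    rw [norm_iteratedFDeriv_eq_norm_iteratedDeriv, hFd, Real.norm_eq_abs, abs_mul, abs_mul,
      abs_of_pos (pow_pos (hl0 j) k)]
    exact mul_le_mul_of_nonneg_left
      (mul_le_mul_of_nonneg_left (hC j k _) (pow_pos (hl0 j) k).le) (abs_nonneg _)
  have hv : ∀ k, Summable (v k) := by
    intro k
    refine Summable.of_norm_bounded_eventually_nat (g := fun j => (1 / 2 : ℝ) ^ j)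
      summable_geometric_two ?_
    filter_upwards [eventually_gt_atTop k] with j hj
    have hl := hl0 j
    have hCk : 2 ^ j * |a j| * C j k ≤ l j := by
      have : C j k ≤ ∑ k ∈ Finset.range j, C j k :=
        Finset.single_le_sum (fun i _ => hC0 j i) (Finset.mem_range.2 hj)
      calc _ ≤ S j := by simp only [S]; gcongr
        _ ≤ l j := by simp [l]
    have hpow : l j ^ k * l j ≤ l j ^ j := by
      rw [← pow_succ]; exact pow_le_pow_right₀ (hl1 j) hj
    have hfac : (1 : ℝ) ≤ j.factorial := mod_cast Nat.one_le_iff_ne_zero.2 j.factorial_ne_zero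
    have hv0 : 0 ≤ v k j := mul_nonneg (abs_nonneg _) (mul_nonneg (by positivity) (hC0 j k))
    rw [Real.norm_of_nonneg hv0]
    simp only [v, c, abs_div, abs_mul, Nat.abs_cast, abs_of_pos (pow_pos hl j)]
    rw [div_mul_eq_mul_div, div_le_iff₀ (by positivity), one_div, inv_pow,
      ← div_eq_inv_mul, le_div_iff₀ (by positivity)]
    calc |a j| * (l j ^ k * C j k) * 2 ^ j = l j ^ k * (2 ^ j * |a j| * C j k) := by ring
      _ ≤ l j ^ k * l j := by gcongr
      _ ≤ l j ^ j := hpow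
      _ ≤ j.factorial * l j ^ j := le_mul_of_one_le_left (by positivity) hfac
  refine ⟨fun x => ∑' j, F j x, contDiff_tsum (N := ⊤) hF (fun k _ => hv k)
    (fun k j x _ => hFv k j x), fun k => ?_⟩
  have h1 := iteratedFDeriv_tsum_apply (N := ⊤) hF (fun k _ => hv k)
    (fun k j x _ => hFv k j x) (k := k) le_top 0
  have hsum : Summable fun j => iteratedFDeriv ℝ k (F j) 0 :=
    Summable.of_norm_bounded (hv k) fun j => hFv k j 0
  rw [iteratedDeriv_eq_iteratedFDeriv, h1, ContinuousMultilinearMap.tsum_eval hsum]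
  simp only [← iteratedDeriv_eq_iteratedFDeriv, hFd, mul_zero, hg0]
  rw [tsum_eq_single k fun j hj => by simp [hj.symm]]
  have := (hl0 k).ne'
  have := k.factorial_ne_zero
  simp only [if_true, c]
  field_simp

/-- A smooth function whose first nonvanishing derivative at `0` is positive is positive to the
right of `0`. -/
theorem eventually_pos_of_iteratedDeriv_pos (k : ℕ) {u : ℝ → ℝ} (hu : ContDiff ℝ ∞ u)
    (h0 : ∀ i < k, iteratedDeriv i u 0 = 0) (hk : 0 < iteratedDeriv k u 0) :
    ∀ᶠ x in 𝓝[>] (0 : ℝ), 0 < u x := by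
  induction k generalizing u with
  | zero =>
    rw [iteratedDeriv_zero] at hk
    exact (hu.continuous.tendsto 0).eventually (lt_mem_nhds hk) |>.filter_mono nhdsWithin_le_nhds
  | succ k ih =>
    have hu' : ContDiff ℝ ∞ (deriv u) := ((contDiff_infty_iff_deriv).1 hu).2
    have := ih hu' (fun i hi => by rw [← iteratedDeriv_succ']; exact h0 _ (by omega))
      (by rw [← iteratedDeriv_succ']; exact hk)
    obtain ⟨δ, hδ, h⟩ := mem_nhdsGT_iff_exists_Ioo_subset.1 this
    have hmono : StrictMonoOn u (Icc 0 δ) := by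
      refine strictMonoOn_of_deriv_pos (convex_Icc 0 δ) hu.continuous.continuousOn fun x hx => ?_
      rw [interior_Icc] at hx
      exact h hx
    have hz : u 0 = 0 := by simpa using h0 0 (by omega)
    filter_upwards [Ioo_mem_nhdsGT hδ] with x hx
    rw [← hz]
    exact hmono ⟨le_rfl, hδ.le⟩ ⟨hx.1.le, hx.2.le⟩ hx.1

theorem iteratedDeriv_expNegInvGlue_zero (k : ℕ) : iteratedDeriv k expNegInvGlue 0 = 0 := by
  have hc : ContDiff ℝ ∞ expNegInvGlue := expNegInvGlue.contDiff
  have hcont := hc.continuous_iteratedDeriv k (mod_cast le_top)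
  have h1 : Tendsto (iteratedDeriv k expNegInvGlue) (𝓝[<] 0) (𝓝 (iteratedDeriv k expNegInvGlue 0)) :=
    (hcont.tendsto 0).mono_left nhdsWithin_le_nhds
  refine tendsto_nhds_unique h1 (tendsto_const_nhds.congr' ?_)
  filter_upwards [self_mem_nhdsWithin] with x hx
  have : expNegInvGlue =ᶠ[𝓝 x] fun _ => 0 := by
    filter_upwards [Iio_mem_nhds hx] with y hy
    exact expNegInvGlue.zero_of_nonpos (le_of_lt hy)
  rw [this.iteratedDeriv_eq]
  simp

/-- A sequence whose first nonzero term, if any, is positive is the sequence of derivatives at `0`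
of a smooth function that is positive to the right of `0`. -/
theorem exists_contDiff_iteratedDeriv_zero_eq_pos (a : ℕ → ℝ)
    (ha : ∀ k, a k ≠ 0 → (∀ i < k, a i = 0) → 0 < a k) :
    ∃ u : ℝ → ℝ, ContDiff ℝ ∞ u ∧ (∀ k, iteratedDeriv k u 0 = a k) ∧
      ∀ᶠ x in 𝓝[>] (0 : ℝ), 0 < u x := by
  classical
  by_cases h : ∃ k, a k ≠ 0
  · obtain ⟨u, hu, hk⟩ := exists_contDiff_iteratedDeriv_zero_eq a
    have hmin : ∀ i < Nat.find h, a i = 0 := fun i hi => not_not.1 (Nat.find_min h hi)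
    refine ⟨u, hu, hk, eventually_pos_of_iteratedDeriv_pos (Nat.find h) hu
      (fun i hi => by rw [hk, hmin i hi]) ?_⟩
    rw [hk]
    exact ha _ (Nat.find_spec h) hmin
  · push Not at h
    -- The zero jet needs a flat function that is still positive to the right of `0`.
    refine ⟨expNegInvGlue, expNegInvGlue.contDiff, fun k => ?_, ?_⟩
    · rw [iteratedDeriv_expNegInvGlue_zero, h]
    · filter_upwards [self_mem_nhdsWithin] with x hx
      exact expNegInvGlue.pos_of_pos hx

/-! ### Taylor's formula at `1` -/

/-- The kernel `(1 - t)^k / k!` of the integral remainder of Taylor expansions at `1`. -/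
noncomputable def taylorKernel (k : ℕ) (t : ℝ) : ℝ := (1 - t) ^ k / k.factorial

theorem continuous_taylorKernel (k : ℕ) : Continuous (taylorKernel k) := by
  unfold taylorKernel; fun_prop

theorem hasDerivAt_taylorKernel_succ (k : ℕ) (t : ℝ) :
    HasDerivAt (taylorKernel (k + 1)) (-taylorKernel k t) t := by
  have h := (((hasDerivAt_id t).const_sub 1).pow (k + 1)).div_const ((k + 1).factorial : ℝ)
  refine h.congr_deriv ?_
  have h1 := k.factorial_ne_zero
  simp only [taylorKernel, Nat.factorial_succ, Nat.cast_mul, Nat.cast_add, Nat.cast_one, id,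
    Nat.add_sub_cancel]
  have h2 : (k : ℝ) + 1 ≠ 0 := by positivity
  field_simp

theorem taylorKernel_succ_one (k : ℕ) : taylorKernel (k + 1) 1 = 0 := by simp [taylorKernel]

theorem taylorKernel_zero (t : ℝ) : taylorKernel 0 t = 1 := by simp [taylorKernel]

theorem abs_taylorKernel_le {t : ℝ} (ht : t ∈ Icc (0 : ℝ) 1) (k : ℕ) : |taylorKernel k t| ≤ 1 := by
  have h0 : 0 ≤ 1 - t := by linarith [ht.2]
  have h1 : (1 - t) ^ k ≤ 1 := pow_le_one₀ h0 (by linarith [ht.1])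
  have hfac : (1 : ℝ) ≤ k.factorial := mod_cast Nat.one_le_iff_ne_zero.2 k.factorial_ne_zero
  rw [taylorKernel, abs_of_nonneg (by positivity), div_le_one (by positivity)]
  exact h1.trans hfac

theorem uniqueDiffOn_unitInterval : UniqueDiffOn ℝ (Icc (0 : ℝ) 1) :=
  uniqueDiffOn_Icc zero_lt_one

/-- Integration by parts: the boundary terms vanish because the kernel is zero at `1` and `u` is
zero at `0`. -/
theorem integral_taylorKernel_succ_mul {u u' : ℝ → ℝ} (hu : ContinuousOn u (Icc 0 1))
    (hd : ∀ x ∈ Ioo (0 : ℝ) 1, HasDerivAt u (u' x) x) (hu' : ContinuousOn u' (Icc 0 1))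
    (h0 : u 0 = 0) (k : ℕ) :
    ∫ t in (0 : ℝ)..1, taylorKernel (k + 1) t * u' t = ∫ t in (0 : ℝ)..1, taylorKernel k t * u t := by
  have h := intervalIntegral.integral_mul_deriv_eq_deriv_mul_of_hasDerivAt (a := 0) (b := 1)
    (u := taylorKernel (k + 1)) (u' := fun t => -taylorKernel k t) (v := u) (v' := u')
    (continuous_taylorKernel _).continuousOn (by simpa using hu)
    (fun x _ => hasDerivAt_taylorKernel_succ k x) (by simpa using hd)
    ((continuous_taylorKernel k).neg.intervalIntegrable _ _)
    (ContinuousOn.intervalIntegrable (by simpa using hu'))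
  rw [h, taylorKernel_succ_one, h0]
  simp

theorem hasDerivAt_D {m : ℕ} {f : ℝ → ℝ} (hf : ContDiffOn ℝ m f (Icc 0 1)) {j : ℕ} (hj : j < m)
    {x : ℝ} (hx : x ∈ Ioo (0 : ℝ) 1) : HasDerivAt (D j f) (D (j + 1) f x) x := by
  have h := hf.differentiableOn_iteratedDerivWithin (m := j) (mod_cast hj)
    uniqueDiffOn_unitInterval x (Ioo_subset_Icc_self hx)
  have := (h.hasDerivWithinAt).hasDerivAt (Icc_mem_nhds hx.1 hx.2)
  rwa [← iteratedDerivWithin_succ] at this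

theorem continuousOn_D {m : ℕ} {f : ℝ → ℝ} (hf : ContDiffOn ℝ m f (Icc 0 1)) {j : ℕ} (hj : j ≤ m) :
    ContinuousOn (D j f) (Icc 0 1) :=
  hf.continuousOn_iteratedDerivWithin (mod_cast hj) uniqueDiffOn_unitInterval

/-- Taylor's formula at `1` for a function whose derivatives of order below `m` vanish at `0`. -/
theorem D_one_eq_integral {m : ℕ} {f : ℝ → ℝ} (hf : ContDiffOn ℝ m f (Icc 0 1))
    (h0 : ∀ i < m, D i f 0 = 0) (k : ℕ) : ∀ j, j + k + 1 ≤ m →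
    D j f 1 = ∫ t in (0 : ℝ)..1, taylorKernel k t * D (j + k + 1) f t := by
  induction k with
  | zero =>
    intro j hj
    simp only [taylorKernel_zero, one_mul, add_zero]
    rw [intervalIntegral.integral_eq_sub_of_hasDerivAt_of_le zero_le_one
      (continuousOn_D hf (by omega)) (fun x hx => hasDerivAt_D hf (by omega) hx)
      (ContinuousOn.intervalIntegrable (by simpa using continuousOn_D hf (by omega))),
      h0 j (by omega), sub_zero]
  | succ k ih =>
    intro j hj
    rw [ih j (by omega)]
    exact (integral_taylorKernel_succ_mul (u := D (j + k + 1) f)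
      (continuousOn_D hf (by omega)) (fun x hx => hasDerivAt_D hf (by omega) hx)
      (continuousOn_D hf (by omega)) (h0 _ (by omega)) k).symm

theorem D_eq_iteratedDeriv {f : ℝ → ℝ} (hf : ContDiff ℝ ∞ f) (j : ℕ) {x : ℝ}
    (hx : x ∈ Icc (0 : ℝ) 1) : D j f x = iteratedDeriv j f x :=
  iteratedDerivWithin_eq_iteratedDeriv uniqueDiffOn_unitInterval
    (hf.contDiffAt.of_le (mod_cast le_top)) hx

theorem exists_iteratedDeriv_succ_eq (n : ℕ) {h : ℝ → ℝ} (hh : ContDiff ℝ ∞ h) :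
    ∃ f : ℝ → ℝ, ContDiff ℝ ∞ f ∧ iteratedDeriv (n + 1) f = h ∧
      ∀ j ≤ n, iteratedDeriv j f 0 = 0 := by
  have key : ∀ {h : ℝ → ℝ}, ContDiff ℝ ∞ h → ∃ F : ℝ → ℝ, ContDiff ℝ ∞ F ∧ deriv F = h ∧ F 0 = 0 := by
    intro h hh
    have hd : ∀ x, HasDerivAt (fun x => ∫ t in (0 : ℝ)..x, h t) (h x) x := fun x =>
      intervalIntegral.integral_hasDerivAt_right (hh.continuous.intervalIntegrable _ _)
        (hh.continuous.stronglyMeasurableAtFilter _ _) hh.continuous.continuousAt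
    have hd' : deriv (fun x => ∫ t in (0 : ℝ)..x, h t) = h := funext fun x => (hd x).deriv
    refine ⟨_, contDiff_infty_iff_deriv.2 ⟨fun x => (hd x).differentiableAt, ?_⟩, hd', by simp⟩
    rwa [hd']
  induction n generalizing h with
  | zero =>
    obtain ⟨F, hF, hd, h0⟩ := key hh
    refine ⟨F, hF, by simpa using hd, fun j hj => ?_⟩
    obtain rfl : j = 0 := by omega
    simpa using h0
  | succ n ih =>
    obtain ⟨F, hF, hd, h0⟩ := key hh
    obtain ⟨f, hf, hfF, hf0⟩ := ih hF
    refine ⟨f, hf, by rw [iteratedDeriv_succ, hfF, hd], fun j hj => ?_⟩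
    rcases hj.lt_or_eq with h | rfl
    · exact hf0 j (by omega)
    · rw [hfF, h0]

/-! ### Moments of positive densities with prescribed endpoint jets -/

/-- The values at `1` of the derivatives of order at most `n` of the function with vanishing
derivatives of order at most `n` at `0` and with derivative `h` of order `n + 1`. -/
noncomputable def moments (n : ℕ) (h : ℝ → ℝ) : Fin (n + 1) → ℝ :=
  fun j => ∫ t in (0 : ℝ)..1, taylorKernel (n - j) t * h t

/-- The smooth functions that are positive on `(0,1)` and have prescribed derivatives at the
endpoints. -/
def densities (a c : ℕ → ℝ) : Set (ℝ → ℝ) :=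
  {h | ContDiff ℝ ∞ h ∧ (∀ x ∈ Ioo (0 : ℝ) 1, 0 < h x) ∧
    (∀ k, iteratedDeriv k h 0 = a k) ∧ ∀ k, iteratedDeriv k h 1 = c k}

/-- Integrating a density `n + 1` times from `0` turns it into a function `f`, so that finding `f`
with given endpoint data reduces to finding a density with given moments. -/
theorem exists_memFInf_of_density {n : ℕ} {a c : ℕ → ℝ} {h : ℝ → ℝ} (hh : h ∈ densities a c) :
    ∃ f : ℝ → ℝ, MemFInf n f ∧ (∀ j : Fin (n + 1), D j f 0 = 0 ∧ D j f 1 = moments n h j) ∧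
      ∀ k, D (n + 1 + k) f 0 = a k ∧ D (n + 1 + k) f 1 = c k := by
  obtain ⟨hs, hpos, h0, h1⟩ := hh
  obtain ⟨f, hf, hfh, hf0⟩ := exists_iteratedDeriv_succ_eq n hs
  have hDh : ∀ x ∈ Icc (0 : ℝ) 1, D (n + 1) f x = h x := fun x hx => by
    rw [D_eq_iteratedDeriv hf _ hx, hfh]
  have hk : ∀ k, iteratedDeriv (n + 1 + k) f = iteratedDeriv k h := fun k => by
    rw [← hfh, iteratedDeriv_eq_iterate, iteratedDeriv_eq_iterate, iteratedDeriv_eq_iterate,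
      ← Function.iterate_add_apply, add_comm]
  have z : (0 : ℝ) ∈ Icc (0 : ℝ) 1 := ⟨le_rfl, zero_le_one⟩
  have o : (1 : ℝ) ∈ Icc (0 : ℝ) 1 := ⟨zero_le_one, le_rfl⟩
  have hD0 : ∀ i < n + 1, D i f 0 = 0 := fun i hi => by
    rw [D_eq_iteratedDeriv hf _ z, hf0 i (by omega)]
  refine ⟨f, ⟨hf.contDiffOn, fun x hx => ?_⟩, fun j => ⟨hD0 j j.2, ?_⟩, fun k => ⟨?_, ?_⟩⟩
  · rw [hDh x (Ioo_subset_Icc_self hx)]; exact hpos x hx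
  · rw [D_one_eq_integral (m := n + 1) (hf.contDiffOn.of_le (mod_cast le_top)) hD0 (n - j) j
      (by omega), moments]
    refine intervalIntegral.integral_congr fun t ht => ?_
    rw [uIcc_of_le zero_le_one] at ht
    rw [show (j : ℕ) + (n - j) + 1 = n + 1 by omega, hDh t ht]
  · rw [D_eq_iteratedDeriv hf _ z, hk, h0]
  · rw [D_eq_iteratedDeriv hf _ o, hk, h1]

theorem moments_add (n : ℕ) {g h : ℝ → ℝ} (hg : Continuous g) (hh : Continuous h) :
    moments n (fun t => g t + h t) = moments n g + moments n h := by
  ext j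
  simp only [moments, Pi.add_apply, mul_add]
  exact intervalIntegral.integral_add
    (((continuous_taylorKernel _).mul hg).intervalIntegrable _ _)
    (((continuous_taylorKernel _).mul hh).intervalIntegrable _ _)

theorem moments_const_mul (n : ℕ) (s : ℝ) (h : ℝ → ℝ) :
    moments n (fun t => s * h t) = s • moments n h := by
  ext j
  simp only [moments, Pi.smul_apply, smul_eq_mul, mul_left_comm _ s]
  exact intervalIntegral.integral_const_mul _ _

theorem convex_densities (a c : ℕ → ℝ) : Convex ℝ (densities a c) := by
  rintro g ⟨hg, hgp, hg0, hg1⟩ h ⟨hh, hhp, hh0, hh1⟩ s t hs ht hst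
  have key : ∀ k x, iteratedDeriv k (fun y => s * g y + t * h y) x =
      s * iteratedDeriv k g x + t * iteratedDeriv k h x := fun k x => by
    rw [iteratedDeriv_fun_add, iteratedDeriv_const_mul_field, iteratedDeriv_const_mul_field]
    · exact (contDiff_const.mul hg).contDiffAt.of_le (mod_cast le_top)
    · exact (contDiff_const.mul hh).contDiffAt.of_le (mod_cast le_top)
  refine ⟨(contDiff_const.mul hg).add (contDiff_const.mul hh), fun x hx => ?_, fun k => ?_,
    fun k => ?_⟩
  · exact (convex_Ioi (0 : ℝ)) (hgp x hx) (hhp x hx) hs ht hst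
  · rw [show s • g + t • h = fun y => s * g y + t * h y from rfl, key, hg0, hh0, ← add_mul, hst,
      one_mul]
  · rw [show s • g + t • h = fun y => s * g y + t * h y from rfl, key, hg1, hh1, ← add_mul, hst,
      one_mul]

theorem convex_moments_image (n : ℕ) (a c : ℕ → ℝ) : Convex ℝ (moments n '' densities a c) := by
  rintro _ ⟨g, hg, rfl⟩ _ ⟨h, hh, rfl⟩ s t hs ht hst
  refine ⟨_, convex_densities a c hg hh hs ht hst, ?_⟩
  simp only [← moments_const_mul]
  exact moments_add n (g := fun y => s * g y) (h := fun y => t * h y)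
    (continuous_const.mul hg.1.continuous) (continuous_const.mul hh.1.continuous)

/-- There are smooth functions with prescribed admissible derivatives at the endpoints that are
positive on `(0,1)` and have arbitrarily small moments. -/
theorem zero_mem_closure_moments_image (n : ℕ) {a c : ℕ → ℝ}
    (ha : ∀ k, a k ≠ 0 → (∀ i < k, a i = 0) → 0 < a k)
    (hc : ∀ k, c k ≠ 0 → (∀ i < k, c i = 0) → 0 < (-1) ^ k * c k) :
    (0 : Fin (n + 1) → ℝ) ∈ closure (moments n '' densities a c) := by
  obtain ⟨u, hu, hua, hup⟩ := exists_contDiff_iteratedDeriv_zero_eq_pos a ha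
  -- The signs `(-1)^k` come from the reflection `x ↦ 1 - x`, which carries the right endpoint to
  -- `0`.
  obtain ⟨v, hv, hvc, hvp⟩ := exists_contDiff_iteratedDeriv_zero_eq_pos (fun k => (-1) ^ k * c k)
    (fun k hk hi => hc k (right_ne_zero_of_mul hk) fun i hik => by simpa using hi i hik)
  obtain ⟨δ, hδ, hup⟩ := mem_nhdsGT_iff_exists_Ioo_subset.1 hup
  obtain ⟨ε, hε, hvp⟩ := mem_nhdsGT_iff_exists_Ioo_subset.1 hvp
  rw [mem_Ioi] at hδ hε
  let χ : ContDiffBump (0 : ℝ) := ⟨1, 2, by norm_num, by norm_num⟩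
  have hχ0 : ∀ y, 2 ≤ y → χ y = 0 := fun y hy => χ.zero_of_le_dist (by
    rw [Real.dist_eq, sub_zero]; exact hy.trans (le_abs_self y))
  have hχ1 : ∀ y, |y| ≤ 1 → χ y = 1 := fun y hy => χ.one_of_mem_closedBall (by
    rwa [mem_closedBall_zero_iff])
  -- Equal to `u` near `0`, to the reflected `v` near `1`, and to `1/k` in between. The transition
  -- zones have width `2/k`, so for large `k` they are disjoint and `u`, `v` are positive on them.
  let h : ℕ → ℝ → ℝ := fun k x => χ (k * x) * u x + χ (k * (1 - x)) * v (1 - x) +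
    (1 - χ (k * x) - χ (k * (1 - x))) * (k : ℝ)⁻¹
  have hh : ∀ k, ContDiff ℝ ∞ (h k) := fun k => by
    have h1 : ContDiff ℝ ∞ fun x : ℝ => χ (k * x) := χ.contDiff.comp (by fun_prop)
    have h2 : ContDiff ℝ ∞ fun x : ℝ => χ (k * (1 - x)) := χ.contDiff.comp (by fun_prop)
    have h3 : ContDiff ℝ ∞ fun x : ℝ => v (1 - x) := hv.comp (by fun_prop)
    exact ((h1.mul hu).add (h2.mul h3)).add (((contDiff_const.sub h1).sub h2).mul contDiff_const)
  have hmem : ∀ᶠ k : ℕ in atTop, h k ∈ densities a c := by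
    have hlim := tendsto_natCast_atTop_atTop (R := ℝ)
    filter_upwards [hlim.eventually_gt_atTop 4, hlim.eventually_gt_atTop (2 / δ),
      hlim.eventually_gt_atTop (2 / ε)] with k h4 hkδ hkε
    have hk0 : (0 : ℝ) < k := by linarith
    rw [div_lt_iff₀ hδ] at hkδ
    rw [div_lt_iff₀ hε] at hkε
    have hl : ∀ x : ℝ, x ≤ 1 / 2 → χ (k * (1 - x)) = 0 := fun x hx => hχ0 _ (by nlinarith)
    have hr : ∀ x : ℝ, 1 / 2 ≤ x → χ (k * x) = 0 := fun x hx => hχ0 _ (by nlinarith)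
    have hone : ∀ x : ℝ, |x| < (k : ℝ)⁻¹ → χ (k * x) = 1 := fun x hx => hχ1 _ (by
      have := mul_lt_mul_of_pos_left hx hk0
      rw [mul_inv_cancel₀ hk0.ne'] at this
      rw [abs_mul, abs_of_pos hk0]
      exact this.le)
    refine ⟨hh k, fun x hx => ?_, fun j => ?_, fun j => ?_⟩
    · rcases le_total x (1 / 2) with hx2 | hx2
      · simp only [h, hl x hx2, zero_mul, add_zero, sub_zero]
        rcases lt_or_ge (k * x) 2 with hkx | hkx
        · have hux : 0 < u x := hup ⟨hx.1, by nlinarith⟩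
          have : 0 < χ (k * x) := χ.pos_of_mem_ball (by
            rw [mem_ball_zero_iff, Real.norm_of_nonneg (by nlinarith [hx.1])]; exact hkx)
          have := χ.le_one (x := k * x)
          have : 0 ≤ (1 - χ (k * x)) * (k : ℝ)⁻¹ := mul_nonneg (by linarith) (by positivity)
          positivity
        · rw [hχ0 _ hkx]; simpa using hk0
      · simp only [h, hr x hx2, zero_mul, zero_add, sub_zero]
        rcases lt_or_ge (k * (1 - x)) 2 with hkx | hkx
        · have hvx : 0 < v (1 - x) := hvp ⟨by linarith [hx.2], by nlinarith⟩
          have : 0 < χ (k * (1 - x)) := χ.pos_of_mem_ball (by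
            rw [mem_ball_zero_iff, Real.norm_of_nonneg (by nlinarith [hx.2])]; exact hkx)
          have := χ.le_one (x := k * (1 - x))
          have : 0 ≤ (1 - χ (k * (1 - x))) * (k : ℝ)⁻¹ := mul_nonneg (by linarith) (by positivity)
          positivity
        · rw [hχ0 _ hkx]; simpa using hk0
    · have : h k =ᶠ[𝓝 0] u := by
        filter_upwards [Metric.ball_mem_nhds (0 : ℝ) (inv_pos.2 hk0),
          Iio_mem_nhds (show (0 : ℝ) < 1 / 2 by norm_num)] with x hx hx2
        rw [mem_ball_zero_iff, Real.norm_eq_abs] at hx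
        simp [h, hone x hx, hl x (le_of_lt hx2)]
      rw [this.iteratedDeriv_eq, hua]
    · have : h k =ᶠ[𝓝 1] fun x => v (1 - x) := by
        filter_upwards [Metric.ball_mem_nhds (1 : ℝ) (inv_pos.2 hk0),
          Ioi_mem_nhds (show (1 / 2 : ℝ) < 1 by norm_num)] with x hx hx2
        rw [Metric.mem_ball', Real.dist_eq] at hx
        simp [h, hone _ hx, hr x (le_of_lt hx2)]
      rw [this.iteratedDeriv_eq, iteratedDeriv_comp_const_sub]
      simp only [sub_self, hvc, smul_eq_mul, ← mul_assoc, ← mul_pow]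
      simp
  refine mem_closure_of_tendsto ?_ (hmem.mono fun k hk => mem_image_of_mem (moments n) hk)
  rw [tendsto_pi_nhds]
  intro j
  obtain ⟨C, hC⟩ := isCompact_Icc.exists_bound_of_continuousOn (s := Icc (0 : ℝ) 1)
    hu.continuous.continuousOn
  obtain ⟨C', hC'⟩ := isCompact_Icc.exists_bound_of_continuousOn (s := Icc (0 : ℝ) 1)
    hv.continuous.continuousOn
  have hlim := intervalIntegral.tendsto_integral_filter_of_dominated_convergence
    (μ := volume) (a := 0) (b := 1) (l := atTop) (F := fun k t => taylorKernel (n - j) t * h k t)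
    (f := fun _ => 0) (fun _ => C + C' + 1) (.of_forall fun k =>
      ((continuous_taylorKernel _).mul (hh k).continuous).aestronglyMeasurable)
    (.of_forall fun k => .of_forall fun x hx => ?_) (by simp) ?_
  · simpa [moments] using hlim
  · rw [uIoc_of_le zero_le_one] at hx
    have hx' : x ∈ Icc (0 : ℝ) 1 := Ioc_subset_Icc_self hx
    have hK := abs_taylorKernel_le hx' (n - j)
    have h1 := hC x hx'
    have h2 := hC' (1 - x) ⟨by linarith [hx.2], by linarith [hx.1]⟩
    have hp0 := χ.nonneg (x := k * x)
    have hp1 := χ.le_one (x := k * x)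
    have hq0 := χ.nonneg (x := k * (1 - x))
    have hq1 := χ.le_one (x := k * (1 - x))
    have h3 : |1 - χ (k * x) - χ (k * (1 - x))| ≤ 1 := abs_le.2 ⟨by linarith, by linarith⟩
    have hk : |(k : ℝ)⁻¹| ≤ 1 := by
      rw [abs_inv, Nat.abs_cast]; exact Nat.cast_inv_le_one k
    rw [Real.norm_eq_abs] at h1 h2 ⊢
    have hle : |h k x| ≤ C + C' + 1 := by
      refine (abs_add_three _ _ _).trans (add_le_add_three ?_ ?_ ?_)
      · rw [abs_mul, abs_of_nonneg hp0]
        exact (mul_le_of_le_one_left (abs_nonneg _) hp1).trans h1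
      · rw [abs_mul, abs_of_nonneg hq0]
        exact (mul_le_of_le_one_left (abs_nonneg _) hq1).trans h2
      · rw [abs_mul]
        exact mul_le_one₀ h3 (abs_nonneg _) hk
    rw [abs_mul]
    exact (mul_le_of_le_one_left (abs_nonneg _) hK).trans hle
  -- The point `1` is discarded because `h k` takes the value `v 0` there for large `k`, which need
  -- not tend to `0`.
  · filter_upwards [compl_mem_ae_iff.2 (measure_singleton (1 : ℝ))] with x hx1 hx
    rw [uIoc_of_le zero_le_one] at hx
    have hx1 : 0 < 1 - x := sub_pos.2 (lt_of_le_of_ne hx.2 hx1)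
    have hev : ∀ᶠ k : ℕ in atTop, taylorKernel (n - j) x * (k : ℝ)⁻¹ =
        taylorKernel (n - j) x * h k x := by
      have hlim := tendsto_natCast_atTop_atTop (R := ℝ)
      filter_upwards [hlim.eventually_gt_atTop (2 / x), hlim.eventually_gt_atTop (2 / (1 - x))]
        with k hk hk'
      rw [div_lt_iff₀ hx.1] at hk
      rw [div_lt_iff₀ hx1] at hk'
      simp [h, hχ0 _ hk.le, hχ0 _ hk'.le]
    refine Tendsto.congr' hev ?_
    simpa using (tendsto_inv_atTop_nhds_zero_nat (𝕜 := ℝ)).const_mul (taylorKernel (n - j) x)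

/-! ### Adding point masses and passing from the closure to the set -/

/-- The moments of the unit mass at `x`. -/
noncomputable def diracMoments (n : ℕ) (x : ℝ) : Fin (n + 1) → ℝ := fun j => taylorKernel (n - j) x

theorem continuous_diracMoments (n : ℕ) : Continuous (diracMoments n) :=
  continuous_pi fun _ => continuous_taylorKernel _

/-- A narrow bump of mass `w` around an interior point leaves both endpoint jets unchanged, and its
moments tend to those of the point mass. Limits then allow `u` in the closure and `x` at an
endpoint. -/
theorem add_smul_diracMoments_mem_closure {n : ℕ} {a c : ℕ → ℝ} {u : Fin (n + 1) → ℝ}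
    (hu : u ∈ closure (moments n '' densities a c)) {w : ℝ} (hw : 0 ≤ w) {x : ℝ}
    (hx : x ∈ Icc (0 : ℝ) 1) :
    u + w • diracMoments n x ∈ closure (moments n '' densities a c) := by
  have key : ∀ x ∈ Ioo (0 : ℝ) 1, ∀ u ∈ moments n '' densities a c,
      u + w • diracMoments n x ∈ closure (moments n '' densities a c) := by
    rintro x hx _ ⟨h, ⟨hh, hp, h0, h1⟩, rfl⟩
    let φ : ℕ → ContDiffBump (0 : ℝ) := fun i =>
      ⟨1 / ((i : ℝ) + 1) / 2, 1 / ((i : ℝ) + 1), by positivity, half_lt_self (by positivity)⟩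
    have hφ : Tendsto (fun i => (φ i).rOut) atTop (𝓝 0) := tendsto_one_div_add_atTop_nhds_zero_nat
    let g : ℕ → ℝ → ℝ := fun i t => (φ i).normed volume (x - t)
    have hg : ∀ i, ContDiff ℝ ∞ (g i) := fun i =>
      ((φ i).contDiff_normed (n := ⊤)).comp (contDiff_const.sub contDiff_id)
    have hg0 : ∀ i t, (φ i).rOut ≤ |x - t| → g i t = 0 := fun i t ht => by
      have : x - t ∉ Function.support ((φ i).normed volume) := by
        rw [ContDiffBump.support_normed_eq]
        simpa using ht
      exact Function.notMem_support.1 this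
    have hlim : Tendsto (fun i => moments n (g i)) atTop (𝓝 (diracMoments n x)) := by
      rw [tendsto_pi_nhds]
      intro j
      refine (ContDiffBump.convolution_tendsto_right_of_continuous hφ
        (continuous_taylorKernel (n - j)) x (μ := volume)).congr' ?_
      filter_upwards [hφ.eventually_lt_const hx.1,
        hφ.eventually_lt_const (sub_pos.2 hx.2)] with i hi0 hi1
      rw [convolution_def, moments, intervalIntegral.integral_eq_integral_of_support_subset,
        ← integral_sub_left_eq_self _ volume x]
      · refine integral_congr_ae (.of_forall fun t => ?_)
        simp [g, mul_comm]
      · intro t ht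
        by_contra hcon
        refine ht ?_
        simp only
        rw [hg0, mul_zero]
        rw [mem_Ioc, not_and_or, not_lt, not_le] at hcon
        rcases hcon with h | h
        · exact le_trans (by linarith) (le_abs_self _)
        · exact le_trans (by linarith) (neg_le_abs _)
    refine mem_closure_of_tendsto (tendsto_const_nhds.add (hlim.const_smul w)) ?_
    filter_upwards [hφ.eventually_lt_const hx.1,
        hφ.eventually_lt_const (sub_pos.2 hx.2)] with i hi0 hi1
    refine ⟨fun t => h t + w * g i t, ⟨hh.add (contDiff_const.mul (hg i)), fun t ht => ?_, fun k => ?_,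
      fun k => ?_⟩, ?_⟩
    · exact add_pos_of_pos_of_nonneg (hp t ht) (mul_nonneg hw ((φ i).nonneg_normed _))
    · have : (fun t => h t + w * g i t) =ᶠ[𝓝 0] h := by
        filter_upwards [Iio_mem_nhds (sub_pos.2 hi0)] with t ht
        rw [mem_Iio] at ht
        rw [hg0 i t (le_trans (by linarith) (le_abs_self _))]
        simp
      rw [this.iteratedDeriv_eq, h0]
    · have : (fun t => h t + w * g i t) =ᶠ[𝓝 1] h := by
        filter_upwards [Ioi_mem_nhds (lt_sub_iff_add_lt'.1 hi1)] with t ht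
        rw [mem_Ioi] at ht
        rw [hg0 i t (le_trans (by linarith) (neg_le_abs _))]
        simp
      rw [this.iteratedDeriv_eq, h1]
    · rw [← moments_const_mul]
      exact moments_add n (h := fun t => w * g i t) hh.continuous
        (continuous_const.mul (hg i).continuous)
  have key' : ∀ x ∈ Ioo (0 : ℝ) 1, u + w • diracMoments n x ∈ closure (moments n '' densities a c) :=
    fun x hx => by
      have hcont : Continuous fun u : Fin (n + 1) → ℝ => u + w • diracMoments n x := by fun_prop
      simpa using map_mem_closure hcont hu (key x hx)
  rw [← closure_Ioo zero_ne_one] at hx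
  have hcont : Continuous fun x => u + w • diracMoments n x :=
    continuous_const.add ((continuous_diracMoments n).const_smul w)
  simpa using map_mem_closure hcont hx key'

/-- An open set contained in the closure of a convex set `V` is contained in `V`. -/
theorem subset_of_isOpen_of_subset_closure {E : Type*} [NormedAddCommGroup E] [NormedSpace ℝ E]
    [FiniteDimensional ℝ E] {S V : Set E} (hS : IsOpen S) (hV : Convex ℝ V) (h : S ⊆ closure V) :
    S ⊆ V := by
  rcases S.eq_empty_or_nonempty with rfl | hne
  · exact empty_subset _
  -- Affine subspaces are closed in finite dimension, so the span of `V` contains the open set `S`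
  -- and is everything. Thus `V` has interior points, and a convex set with interior points has the
  -- same interior as its closure.
  have hspan : affineSpan ℝ V = ⊤ := by
    refine top_le_iff.1 ((hS.affineSpan_eq_top hne).symm.trans_le (affineSpan_le.2 (h.trans ?_)))
    exact closure_minimal (subset_affineSpan ℝ V) (AffineSubspace.closed_of_finiteDimensional _)
  have hint := hV.interior_nonempty_iff_affineSpan_eq_top.2 hspan
  calc S ⊆ interior (closure V) := interior_maximal h hS
    _ = interior V := hV.interior_closure_eq_interior_of_nonempty_interior hint
    _ ⊆ V := interior_subset

/-- If every point of an open set is the moment vector of a finite positive combination of unit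
masses on `[0,1]`, then this set is contained in `W_n^∞`. -/
theorem subset_WInf {n m : ℕ} {S : Set (Fin (n + 1) → ℝ)} (hS : IsOpen S)
    (h : ∀ b ∈ S, ∃ w x : Fin m → ℝ, (∀ i, 0 ≤ w i ∧ x i ∈ Icc (0 : ℝ) 1) ∧
      b = ∑ i, w i • diracMoments n (x i)) : S ⊆ WInf n := by
  intro b hb α hα β hβ
  set V := moments n '' densities (fun k => α (n + 1 + k)) (fun k => β (n + 1 + k)) with hVdef
  have h0 : (0 : Fin (n + 1) → ℝ) ∈ closure V := by
    refine zero_mem_closure_moments_image n (fun k hk hi => ?_) (fun k hk hi => ?_)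
    · refine hα.2 (n + 1 + k) (by omega) hk fun i hi1 hi2 => ?_
      obtain ⟨l, rfl⟩ : ∃ l, i = n + 1 + l := ⟨i - (n + 1), by omega⟩
      exact hi l (by omega)
    · have := hβ.2 (n + 1 + k) (by omega) hk fun i hi1 hi2 => by
        obtain ⟨l, rfl⟩ : ∃ l, i = n + 1 + l := ⟨i - (n + 1), by omega⟩
        exact hi l (by omega)
      rwa [show n + (n + 1 + k) + 1 = 2 * (n + 1) + k by ring, pow_add, pow_mul, neg_one_sq,
        one_pow, one_mul] at this
  -- Translations preserving `closure V` form a monoid, so single point masses suffice; the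
  -- combination is then applied to `0`.
  let M : AddSubmonoid (Fin (n + 1) → ℝ) :=
    { carrier := {v | ∀ u ∈ closure V, u + v ∈ closure V}
      add_mem' := fun {v v'} hv hv' u hu => by
        rw [← add_assoc]; exact hv' _ (hv u hu)
      zero_mem' := fun u hu => by rwa [add_zero] }
  have hSV : S ⊆ closure V := fun b hb => by
    obtain ⟨w, x, hwx, rfl⟩ := h b hb
    have : ∑ i, w i • diracMoments n (x i) ∈ M := M.sum_mem fun i _ u hu =>
      add_smul_diracMoments_mem_closure hu (hwx i).1 (hwx i).2
    simpa using this 0 h0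
  obtain ⟨g, hg, hgb⟩ := subset_of_isOpen_of_subset_closure hS (convex_moments_image n _ _) hSV hb
  obtain ⟨f, hf, hfj, hfk⟩ := exists_memFInf_of_density (n := n) hg
  refine ⟨f, hf, fun j => ?_⟩
  rcases Nat.lt_or_ge n j with hj | hj
  · obtain ⟨l, rfl⟩ : ∃ l, j = n + 1 + l := ⟨j - (n + 1), by omega⟩
    exact hfk l
  · have h1 := hα.1 ⟨j, by omega⟩
    have h2 := hβ.1 ⟨j, by omega⟩
    have h3 := hfj ⟨j, by omega⟩
    rw [hgb] at h3
    simp only [Pi.zero_apply] at h1 h2 h3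
    exact ⟨h3.1.trans h1.symm, h3.2.trans h2.symm⟩

/-! ### Relations between `W_n^∞`, `W_n` and `(P_n)` -/

theorem MemFInf.memF {n : ℕ} {f : ℝ → ℝ} (h : MemFInf n f) : MemF n f := by
  obtain ⟨hf, hpos⟩ := h
  have hfn : ContDiffOn ℝ (n + 1 : ℕ) f (Icc 0 1) := hf.of_le (mod_cast le_top)
  have hmono : StrictMonoOn (D n f) (Icc 0 1) := by
    refine strictMonoOn_of_deriv_pos (convex_Icc 0 1) (continuousOn_D hfn (by omega)) fun x hx => ?_
    rw [interior_Icc] at hx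
    rw [(hasDerivAt_D hfn (by omega) hx).deriv]
    exact hpos x hx
  have z : (0 : ℝ) ∈ Icc (0 : ℝ) 1 := ⟨le_rfl, zero_le_one⟩
  have o : (1 : ℝ) ∈ Icc (0 : ℝ) 1 := ⟨zero_le_one, le_rfl⟩
  exact ⟨hf.of_le (mod_cast le_top), hmono.monotoneOn, 0, z, 1, o, (hmono z o one_pos).ne⟩

theorem WInf_subset_W (n : ℕ) : WInf n ⊆ W n := by
  intro b hb
  -- With all higher terms zero, the sign conditions on the sequences hold vacuously.
  let β : ℕ → ℝ := fun j => if h : j < n + 1 then b ⟨j, h⟩ else 0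
  have hβ : ∀ j, n < j → β j = 0 := fun j hj => dif_neg (by omega)
  obtain ⟨f, hf, hj⟩ := hb 0 ⟨fun j => rfl, fun j _ hj => absurd rfl hj⟩ β
    ⟨fun j => dif_pos j.2, fun j hj hne => absurd (hβ j hj) hne⟩
  exact ⟨f, hf.memF, fun j => ⟨(hj j).1, (hj j).2.trans (dif_pos j.2)⟩⟩

theorem P_of_isOpen_of_subset_WInf {n : ℕ} (ho : IsOpen (W n)) (h : W n ⊆ WInf n) : P n := by
  refine ⟨ho, fun b hb => ?_⟩
  -- The jet demanded by `(P_n)`: the given values, then a single `1` in order `n + 1`, which has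
  -- the admissible sign at both ends since `(-1)^(2(n+1)) = 1`.
  let x : (Fin (n + 1) → ℝ) → ℕ → ℝ := fun b j =>
    if h : j < n + 1 then b ⟨j, h⟩ else if j = n + 1 then 1 else 0
  have hx : ∀ b (j : Fin (n + 1)), x b j = b j := fun b j => dif_pos j.2
  have hx1 : ∀ b, x b (n + 1) = 1 := fun b => by simp [x]
  have hx0 : ∀ b j, n + 1 < j → x b j = 0 := fun b j hj => by
    simp only [x]; rw [dif_neg (by omega), if_neg (by omega)]
  have hxj : ∀ b j, n < j → x b j ≠ 0 → j = n + 1 := fun b j hj hne => by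
    by_contra hcon
    exact hne (hx0 b j (by omega))
  obtain ⟨f, hf, hj⟩ := h hb (x 0) ⟨hx 0, fun j hj hne _ => by
      rw [hxj 0 j hj hne, hx1]; exact one_pos⟩ (x b) ⟨hx b, fun j hj hne _ => by
      rw [hxj b j hj hne, hx1, show n + (n + 1) + 1 = 2 * (n + 1) by ring, pow_mul]; simp⟩
  refine ⟨f, ⟨hf.memF, fun j => ?_⟩, hf, ?_, ?_, fun j hj' => ?_⟩
  · rw [(hj j).1, (hj j).2, hx, hx]; exact ⟨rfl, rfl⟩
  · rw [(hj _).1, hx1]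
  · rw [(hj _).2, hx1]
  · rw [(hj _).1, (hj _).2, hx0 _ _ hj', hx0 _ _ hj']; exact ⟨rfl, rfl⟩

/-! ### Necessity: moments of an atomless measure -/

theorem integral_taylorKernel_Ioc (k : ℕ) {s : ℝ} (hs : s ≤ 1) :
    ∫ t in Ioc s 1, taylorKernel k t = taylorKernel (k + 1) s := by
  rw [← intervalIntegral.integral_of_le hs,
    intervalIntegral.integral_eq_sub_of_hasDerivAt (f := fun t => -taylorKernel (k + 1) t)
    (fun t _ => ((hasDerivAt_taylorKernel_succ k t).neg).congr_deriv (neg_neg _))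
    ((continuous_taylorKernel k).intervalIntegrable _ _), taylorKernel_succ_one]
  ring

/-- A nondecreasing continuous function on `[0,1]` that vanishes at `0` is the distribution function
of an atomless measure on `(0,1]`. -/
theorem exists_measure_Iic_eq {g : ℝ → ℝ} (hc : ContinuousOn g (Icc 0 1))
    (hmono : MonotoneOn g (Icc 0 1)) (h0 : g 0 = 0) :
    ∃ μ : Measure ℝ, IsFiniteMeasure μ ∧ (∀ x, μ {x} = 0) ∧ μ (Ioc 0 1)ᶜ = 0 ∧
      ∀ t ∈ Icc (0 : ℝ) 1, μ (Iic t) = ENNReal.ofReal (g t) := by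
  -- Extending `g` by constants outside `[0,1]` gives a continuous Stieltjes function; continuity is
  -- what excludes atoms.
  have hgc : Continuous (IccExtend zero_le_one ((Icc (0 : ℝ) 1).domRestrict g)) :=
    hc.domRestrict.Icc_extend'
  have hgm : Monotone (IccExtend zero_le_one ((Icc (0 : ℝ) 1).domRestrict g)) :=
    Monotone.IccExtend _ (fun a b hab => hmono a.2 b.2 hab)
  have hgD : ∀ t ∈ Icc (0 : ℝ) 1, IccExtend zero_le_one ((Icc (0 : ℝ) 1).domRestrict g) t =
      g t := fun t ht => by rw [IccExtend_of_mem _ _ ht]; rfl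
  obtain ⟨G, hG⟩ : ∃ G : StieltjesFunction ℝ,
      ∀ t, G t = IccExtend zero_le_one ((Icc (0 : ℝ) 1).domRestrict g) t :=
    ⟨⟨_, hgm, fun x => hgc.continuousWithinAt⟩, fun t => rfl⟩
  have hGc : Continuous G := hgc.congr fun t => (hG t).symm
  have z : (0 : ℝ) ∈ Icc (0 : ℝ) 1 := ⟨le_rfl, zero_le_one⟩
  refine ⟨G.measure.restrict (Ioc 0 1), ⟨?_⟩, fun x => ?_, ?_, fun t ht => ?_⟩
  · rw [Measure.restrict_apply_univ, StieltjesFunction.measure_Ioc]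
    exact ENNReal.ofReal_lt_top
  · refine le_antisymm ((Measure.restrict_apply_le _ _).trans ?_) zero_le
    rw [StieltjesFunction.measure_singleton, leftLim_eq_of_tendsto ((hGc.tendsto x).mono_left nhdsWithin_le_nhds),
      sub_self, ENNReal.ofReal_zero]
  · rw [Measure.restrict_apply measurableSet_Ioc.compl, compl_inter_self, measure_empty]
  · rw [Measure.restrict_apply measurableSet_Iic, inter_comm, Ioc_inter_Iic, min_eq_right ht.2,
      StieltjesFunction.measure_Ioc, hG, hG, hgD t ht, hgD 0 z, h0, sub_zero]

/-- Fubini: write `g t` as the mass of `s ≤ t` and integrate the kernel over `[s,1]` first. This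
replaces integration by parts, since `g = D^n f` need not be differentiable. -/
theorem integral_taylorKernel_mul_eq {μ : Measure ℝ} [IsFiniteMeasure μ] {g : ℝ → ℝ}
    (hcompl : μ (Ioc 0 1)ᶜ = 0) (hg : ∀ t ∈ Icc (0 : ℝ) 1, 0 ≤ g t)
    (hμ : ∀ t ∈ Icc (0 : ℝ) 1, μ (Iic t) = ENNReal.ofReal (g t)) (k : ℕ) :
    ∫ t in (0 : ℝ)..1, taylorKernel k t * g t = ∫ t, taylorKernel (k + 1) t ∂μ := by
  have hmem : ∀ᵐ s ∂μ, s ∈ Ioc (0 : ℝ) 1 := hcompl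
  rw [intervalIntegral.integral_of_le zero_le_one]
  let F : ℝ → ℝ → ℝ := fun t s => (Iic t).indicator (fun _ => taylorKernel k t) s
  have hFi : Integrable (Function.uncurry F) ((volume.restrict (Ioc 0 1)).prod μ) := by
    have h1 : Integrable (taylorKernel k) (volume.restrict (Ioc 0 1)) :=
      ((continuous_taylorKernel k).integrableOn_Icc (a := 0) (b := 1)).mono_set
        Ioc_subset_Icc_self
    have h2 := (h1.mul_prod (integrable_const (μ := μ) (1 : ℝ))).indicator
      (measurableSet_le measurable_snd measurable_fst)
    refine h2.congr (.of_forall fun p => ?_)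
    simp [F, Function.uncurry, indicator]
  calc ∫ t in Ioc 0 1, taylorKernel k t * g t
      = ∫ t in Ioc 0 1, ∫ s, F t s ∂μ := by
        refine setIntegral_congr_fun measurableSet_Ioc fun t ht => ?_
        have ht' := Ioc_subset_Icc_self ht
        simp only [F]
        rw [integral_indicator measurableSet_Iic, setIntegral_const, Measure.real, hμ t ht',
          ENNReal.toReal_ofReal (hg t ht'), smul_eq_mul, mul_comm]
    _ = ∫ s, (∫ t in Ioc 0 1, F t s) ∂μ := integral_integral_swap hFi
    _ = ∫ s, taylorKernel (k + 1) s ∂μ := by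
        refine integral_congr_ae ?_
        filter_upwards [hmem] with s hs
        have : ∀ t, F t s = (Ici s).indicator (taylorKernel k) t := fun t => by
          simp [F, indicator]
        simp only [this]
        rw [integral_indicator measurableSet_Ici, Measure.restrict_restrict measurableSet_Ici,
          ← integral_taylorKernel_Ioc k hs.2, ← integral_Icc_eq_integral_Ioc]
        congr 2
        ext t
        simp only [mem_inter_iff, mem_Ici, mem_Ioc, mem_Icc]
        exact ⟨fun h => ⟨h.1, h.2.2⟩, fun h => ⟨h.1, hs.1.trans_le h.1, h.2⟩⟩

/-- The points of `W_n` are vectors of moments of nonzero atomless measures on `(0,1]`. -/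
theorem exists_measure_of_mem_W {n : ℕ} {b : Fin (n + 1) → ℝ} (hb : b ∈ W n) :
    ∃ μ : Measure ℝ, IsFiniteMeasure μ ∧ (∀ x, μ {x} = 0) ∧ μ (Ioc 0 1)ᶜ = 0 ∧ μ ≠ 0 ∧
      ∀ j : Fin (n + 1), b j = ∫ t, taylorKernel (n - j) t ∂μ := by
  obtain ⟨f, ⟨hf, hmono, x, hx, y, hy, hxy⟩, hj⟩ := hb
  have z : (0 : ℝ) ∈ Icc (0 : ℝ) 1 := ⟨le_rfl, zero_le_one⟩
  have o : (1 : ℝ) ∈ Icc (0 : ℝ) 1 := ⟨zero_le_one, le_rfl⟩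
  have hD0 : D n f 0 = 0 := (hj (Fin.last n)).1
  have hnonneg : ∀ t ∈ Icc (0 : ℝ) 1, 0 ≤ D n f t := fun t ht => hD0 ▸ hmono z ht ht.1
  have hD1 : 0 < D n f 1 := by
    refine lt_of_le_of_ne (hnonneg 1 o) fun h => hxy ?_
    have hz : ∀ t ∈ Icc (0 : ℝ) 1, D n f t = 0 := fun t ht =>
      le_antisymm (h.symm ▸ hmono ht o ht.2) (hnonneg t ht)
    rw [hz x hx, hz y hy]
  obtain ⟨μ, hfin, hatom, hcompl, hμ⟩ := exists_measure_Iic_eq (continuousOn_D hf le_rfl) hmono hD0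
  refine ⟨μ, hfin, hatom, hcompl, fun h => ?_, fun j => ?_⟩
  · have := hμ 1 o
    rw [h] at this
    exact (ENNReal.ofReal_pos.2 hD1).ne this
  · rw [(hj j).2.symm]
    rcases Nat.lt_or_ge j n with hjn | hjn
    · obtain ⟨k, hk⟩ : ∃ k, n = j + k + 1 := ⟨n - j - 1, by omega⟩
      rw [show n - (j : ℕ) = k + 1 by omega,
        D_one_eq_integral hf (fun i hi => (hj ⟨i, by omega⟩).1) k j hk.ge, ← hk,
        integral_taylorKernel_mul_eq hcompl hnonneg hμ]
    · have hmem : ∀ᵐ s ∂μ, s ∈ Ioc (0 : ℝ) 1 := hcompl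
      have : (j : ℕ) = n := by omega
      rw [this, Nat.sub_self]
      simp only [taylorKernel_zero, integral_const, smul_eq_mul, mul_one]
      have h1 : μ univ = μ (Iic 1) := measure_congr (by
        filter_upwards [hmem] with s hs
        exact propext ⟨fun _ => hs.2, fun _ => trivial⟩)
      rw [Measure.real, h1, hμ 1 o, ENNReal.toReal_ofReal hD1.le]

/-- The points of `W_n` are given by sequences of numbers on which every nonzero polynomial of
degree at most three that is nonnegative on `[0,1]` takes positive values. -/
theorem exists_moments_of_mem_W {n : ℕ} {b : Fin (n + 1) → ℝ} (hb : b ∈ W n) :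
    ∃ M : ℕ → ℝ, (∀ j : Fin (n + 1), b j = M (n - j) / (n - j : ℕ).factorial) ∧
      ∀ c₀ c₁ c₂ c₃ : ℝ, ∀ Z : Finset ℝ,
        (∀ s ∈ Icc (0 : ℝ) 1, 0 ≤ c₀ + c₁ * s + c₂ * s ^ 2 + c₃ * s ^ 3 ∧
          (c₀ + c₁ * s + c₂ * s ^ 2 + c₃ * s ^ 3 = 0 → s ∈ Z)) →
        0 < c₀ * M 0 + c₁ * M 1 + c₂ * M 2 + c₃ * M 3 := by
  obtain ⟨μ, hfin, hatom, hcompl, hne, hbj⟩ := exists_measure_of_mem_W hb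
  have hmem : ∀ᵐ s ∂μ, s ∈ Ioc (0 : ℝ) 1 := hcompl
  have hint : ∀ k : ℕ, Integrable (fun t : ℝ => (1 - t) ^ k) μ := fun k => by
    refine Integrable.of_bound (by fun_prop) 1 ?_
    filter_upwards [hmem] with t ht
    rw [Real.norm_eq_abs, abs_pow]
    exact pow_le_one₀ (abs_nonneg _) (abs_le.2 ⟨by linarith [ht.2], by linarith [ht.1]⟩)
  refine ⟨fun k => ∫ t, (1 - t) ^ k ∂μ, fun j => ?_, fun c₀ c₁ c₂ c₃ Z h => ?_⟩
  · rw [hbj j, ← integral_div]; rfl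
  · set q : ℝ → ℝ := fun t => c₀ * (1 - t) ^ 0 + c₁ * (1 - t) ^ 1 + c₂ * (1 - t) ^ 2 +
      c₃ * (1 - t) ^ 3
    have hi0 := (hint 0).const_mul c₀
    have hi1 := (hint 1).const_mul c₁
    have hi2 := (hint 2).const_mul c₂
    have hi3 := (hint 3).const_mul c₃
    have hqi : Integrable q μ := ((hi0.add hi1).add hi2).add hi3
    have hqint : ∫ t, q t ∂μ = c₀ * (∫ t, (1 - t) ^ 0 ∂μ) + c₁ * (∫ t, (1 - t) ^ 1 ∂μ) +
        c₂ * (∫ t, (1 - t) ^ 2 ∂μ) + c₃ * ∫ t, (1 - t) ^ 3 ∂μ := by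
      simp only [← integral_const_mul]
      rw [← integral_add' hi0 hi1, ← integral_add' (hi0.add hi1) hi2,
        ← integral_add' ((hi0.add hi1).add hi2) hi3]
      rfl
    have hs : ∀ t ∈ Ioc (0 : ℝ) 1, 1 - t ∈ Icc (0 : ℝ) 1 := fun t ht =>
      ⟨by linarith [ht.2], by linarith [ht.1]⟩
    have hq0 : 0 ≤ᵐ[μ] q := by
      filter_upwards [hmem] with t ht
      simpa [q] using (h _ (hs t ht)).1
    rw [← hqint, integral_pos_iff_support_of_nonneg_ae hq0 hqi, pos_iff_ne_zero]
    -- If the integral vanished, `μ` would live on the finitely many reflected zeros `1 - z`; having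
    -- no atoms, it would be zero.
    intro h0
    refine hne (Measure.measure_univ_eq_zero.1 (measure_mono_null (t := Function.support q ∪
      ((Ioc 0 1)ᶜ ∪ ⋃ z ∈ Z, {1 - z})) (fun t _ => ?_) ?_))
    · by_cases ht : t ∈ Ioc (0 : ℝ) 1
      · by_cases hqt : q t = 0
        · refine Or.inr (Or.inr (mem_biUnion (x := 1 - t) ((h _ (hs t ht)).2 ?_) (by simp)))
          simpa [q] using hqt
        · exact Or.inl hqt
      · exact Or.inr (Or.inl ht)
    · exact measure_union_null h0 (measure_union_null hcompl
        ((measure_biUnion_null_iff Z.countable_toSet).2 fun z _ => hatom _))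

/-! ### The explicit descriptions for `n = 0, 1, 2, 3` -/

/-- `W_n` is an open set given explicitly if it is contained in it and all points of it are
vectors of moments of finite combinations of unit masses. -/
theorem P_and_W_eq_of_explicit {n m : ℕ} {S : Set (Fin (n + 1) → ℝ)} (hS : IsOpen S)
    (hW : W n ⊆ S) (h : ∀ b ∈ S, ∃ w x : Fin m → ℝ, (∀ i, 0 ≤ w i ∧ x i ∈ Icc (0 : ℝ) 1) ∧
      b = ∑ i, w i • diracMoments n (x i)) : P n ∧ W n = WInf n ∧ W n = S := by
  have h1 := subset_WInf hS h
  have h2 := WInf_subset_W n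
  have h3 : W n = S := hW.antisymm (h1.trans h2)
  exact ⟨P_of_isOpen_of_subset_WInf (h3 ▸ hS) (hW.trans h1), (hW.trans h1).antisymm h2, h3⟩

theorem explicit_zero : P 0 ∧ W 0 = WInf 0 ∧ W 0 = {v : Fin 1 → ℝ | 0 < v 0} := by
  refine P_and_W_eq_of_explicit (m := 1) (isOpen_lt (by fun_prop) (by fun_prop)) (fun b hb => ?_)
    fun b hb => ?_
  · obtain ⟨M, hM, hpos⟩ := exists_moments_of_mem_W hb
    have h0 := hM 0
    have := hpos 1 0 0 0 ∅ (by intro s hs; norm_num)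
    simp at h0
    simp only [mem_ofPred_eq, h0]
    linarith
  · simp only [mem_ofPred_eq] at hb
    refine ⟨fun _ => b 0, fun _ => 0, by simp [hb.le], ?_⟩
    ext j
    fin_cases j
    simp [diracMoments, taylorKernel]

theorem explicit_one :
    P 1 ∧ W 1 = WInf 1 ∧ W 1 = {v : Fin 2 → ℝ | 0 < v 0 ∧ v 0 < v 1} := by
  refine P_and_W_eq_of_explicit (m := 1) ((isOpen_lt (by fun_prop) (by fun_prop)).and
    (isOpen_lt (by fun_prop) (by fun_prop))) (fun b hb => ?_) fun b hb => ?_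
  · obtain ⟨M, hM, hpos⟩ := exists_moments_of_mem_W hb
    have h0 := hM 0
    have h1 := hM 1
    have p1 := hpos 0 1 0 0 {0} (fun s hs => ⟨by linarith [hs.1], fun h => by
      rw [Finset.mem_singleton]; linarith⟩)
    have p2 := hpos 1 (-1) 0 0 {1} (fun s hs => ⟨by linarith [hs.2], fun h => by
      rw [Finset.mem_singleton]; linarith⟩)
    simp at h0 h1
    simp only [mem_ofPred_eq, h0, h1]
    exact ⟨by linarith, by linarith⟩
  · obtain ⟨h0, h1⟩ : 0 < b 0 ∧ b 0 < b 1 := hb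
    have h2 : 0 < b 1 := h0.trans h1
    refine ⟨fun _ => b 1, fun _ => 1 - b 0 / b 1, fun _ => ⟨h2.le, ?_, ?_⟩, ?_⟩
    · rw [sub_nonneg, div_le_one h2]; exact h1.le
    · rw [sub_le_self_iff]; positivity
    · ext j
      fin_cases j
      · simp [diracMoments, taylorKernel]; field_simp
      · simp [diracMoments, taylorKernel]

theorem explicit_two : P 2 ∧ W 2 = WInf 2 ∧
    W 2 = {v : Fin 3 → ℝ | 0 < 2 * v 0 ∧ 2 * v 0 < v 1 ∧ v 1 ^ 2 < 2 * v 0 * v 2} := by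
  refine P_and_W_eq_of_explicit (m := 2) ((isOpen_lt (by fun_prop) (by fun_prop)).and
    ((isOpen_lt (by fun_prop) (by fun_prop)).and (isOpen_lt (by fun_prop) (by fun_prop))))
    (fun b hb => ?_) fun b hb => ?_
  · obtain ⟨M, hM, hpos⟩ := exists_moments_of_mem_W hb
    have h0 := hM 0
    have h1 := hM 1
    have h2 := hM 2
    have p0 := hpos 1 0 0 0 ∅ (by intro s hs; norm_num)
    have p1 := hpos 0 0 1 0 {0} (fun s hs => ⟨by nlinarith [hs.1], fun h => by
      rw [Finset.mem_singleton]; exact pow_eq_zero_iff two_ne_zero |>.1 (by linarith)⟩)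
    have p2 := hpos 0 1 (-1) 0 {0, 1} (fun s hs => ⟨by nlinarith [hs.1, hs.2], fun h => by
      have h' : s * (1 - s) = 0 := by linarith
      rcases mul_eq_zero.1 h' with h | h
      · simp [h]
      · rw [← sub_eq_zero.1 h]; simp⟩)
    simp only [one_mul, zero_mul, add_zero] at p0
    -- The square `(M 1 - M 0 * s)^2` integrates to `M 0 * (M 0 * M 2 - M 1 ^ 2)`, the
    -- Cauchy–Schwarz defect.
    have p3 := hpos (M 1 ^ 2) (-2 * M 1 * M 0) (M 0 ^ 2) 0 {M 1 / M 0} (fun s hs =>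
      ⟨by nlinarith [sq_nonneg (M 1 - M 0 * s)], fun h => by
        have h' : (M 1 - M 0 * s) ^ 2 = 0 := by linarith
        have := pow_eq_zero_iff two_ne_zero |>.1 h'
        rw [Finset.mem_singleton, eq_div_iff p0.ne']; linarith⟩)
    have p4 : 0 < M 0 * M 2 - M 1 ^ 2 := pos_of_mul_pos_right (a := M 0) (by linarith) p0.le
    norm_num [Nat.factorial] at h0 h1 h2
    simp only [mem_ofPred_eq, h0, h1, h2]
    exact ⟨by linarith, by linarith, by linarith⟩
  · obtain ⟨h0, h1, h2⟩ : 0 < 2 * b 0 ∧ 2 * b 0 < b 1 ∧ b 1 ^ 2 < 2 * b 0 * b 2 := hb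
    have h3 : 0 < b 0 := by linarith
    have h4 : 0 < b 1 := by linarith
    -- In the variable `s = 1 - t`, where `M 1 = b 1` and `M 2 = 2 * b 0`: the mass at `s = M 2 / M
    -- 1` is fixed by these two moments, and the rest of the total mass `b 2` goes to `s = 0`.
    refine ⟨![b 2 - b 1 ^ 2 / (2 * b 0), b 1 ^ 2 / (2 * b 0)], ![1, 1 - 2 * b 0 / b 1],
      fun i => ?_, ?_⟩
    · fin_cases i
      · refine ⟨?_, by simp⟩
        simp only [Fin.zero_eta, Matrix.cons_val_zero, sub_nonneg]
        rw [div_le_iff₀ h0]; linarith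
      · simp only [Fin.mk_one, Matrix.cons_val_one, Matrix.cons_val_fin_one]
        refine ⟨by positivity, ?_, ?_⟩
        · rw [sub_nonneg, div_le_one h4]; exact h1.le
        · rw [sub_le_self_iff]; positivity
    · ext j
      fin_cases j <;> simp [diracMoments, taylorKernel, Fin.sum_univ_succ] <;> field_simp

theorem explicit_three : P 3 ∧ W 3 = WInf 3 ∧
    W 3 = {v : Fin 4 → ℝ | 0 < v 2 ∧ v 2 < v 3 ∧ 2 * v 1 ^ 2 < 3 * v 0 * v 2 ∧
        6 * v 0 * v 3 + 4 * v 1 ^ 2 + v 2 ^ 2 <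
          6 * v 0 * v 2 + 2 * v 1 * v 2 + 2 * v 1 * v 3} := by
  refine P_and_W_eq_of_explicit (m := 3) ((isOpen_lt (by fun_prop) (by fun_prop)).and
    ((isOpen_lt (by fun_prop) (by fun_prop)).and ((isOpen_lt (by fun_prop) (by fun_prop)).and
    (isOpen_lt (by fun_prop) (by fun_prop))))) (fun b hb => ?_) fun b hb => ?_
  · obtain ⟨M, hM, hpos⟩ := exists_moments_of_mem_W hb
    have h0 := hM 0
    have h1 := hM 1
    have h2 := hM 2
    have h3 := hM 3
    have p1 := hpos 0 1 0 0 {0} (fun s hs => ⟨by linarith [hs.1], fun h => by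
      rw [Finset.mem_singleton]; linarith⟩)
    have p2 := hpos 1 (-1) 0 0 {1} (fun s hs => ⟨by linarith [hs.2], fun h => by
      rw [Finset.mem_singleton]; linarith⟩)
    have p1' : 0 < M 1 := by linarith
    have p2' : 0 < M 0 - M 1 := by linarith
    have p3 := hpos 0 (M 2 ^ 2) (-2 * M 2 * M 1) (M 1 ^ 2) {0, M 2 / M 1} (fun s hs => by
      have e : 0 + M 2 ^ 2 * s + -2 * M 2 * M 1 * s ^ 2 + M 1 ^ 2 * s ^ 3 =
        s * (M 2 - M 1 * s) ^ 2 := by ring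
      rw [e]
      refine ⟨mul_nonneg hs.1 (sq_nonneg _), fun h => ?_⟩
      rcases mul_eq_zero.1 h with h | h
      · simp [h]
      · have := pow_eq_zero_iff two_ne_zero |>.1 h
        rw [Finset.mem_insert, Finset.mem_singleton, eq_div_iff p1'.ne']
        exact Or.inr (by linarith))
    have p4 : 0 < M 1 * M 3 - M 2 ^ 2 := pos_of_mul_pos_right (a := M 1) (by linarith) p1'.le
    have p5 := hpos ((M 1 - M 2) ^ 2) (-2 * (M 0 - M 1) * (M 1 - M 2) - (M 1 - M 2) ^ 2)
      ((M 0 - M 1) ^ 2 + 2 * (M 0 - M 1) * (M 1 - M 2)) (-(M 0 - M 1) ^ 2)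
      {1, (M 1 - M 2) / (M 0 - M 1)} (fun s hs => by
      have e : (M 1 - M 2) ^ 2 + (-2 * (M 0 - M 1) * (M 1 - M 2) - (M 1 - M 2) ^ 2) * s +
        ((M 0 - M 1) ^ 2 + 2 * (M 0 - M 1) * (M 1 - M 2)) * s ^ 2 + (-(M 0 - M 1) ^ 2) * s ^ 3 =
        (1 - s) * ((M 1 - M 2) - (M 0 - M 1) * s) ^ 2 := by ring
      rw [e]
      refine ⟨mul_nonneg (sub_nonneg.2 hs.2) (sq_nonneg _), fun h => ?_⟩
      rcases mul_eq_zero.1 h with h | h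
      · rw [← sub_eq_zero.1 h]; simp
      · have := pow_eq_zero_iff two_ne_zero |>.1 h
        rw [Finset.mem_insert, Finset.mem_singleton, eq_div_iff p2'.ne']
        exact Or.inr (by linarith))
    have p6 : 0 < (M 0 - M 1) * (M 2 - M 3) - (M 1 - M 2) ^ 2 :=
      pos_of_mul_pos_right (a := M 0 - M 1) (by linarith) p2'.le
    norm_num [Nat.factorial] at h0 h1 h2 h3
    simp only [mem_ofPred_eq, h0, h1, h2, h3]
    exact ⟨by linarith, by linarith, by linarith, by linarith⟩
  · obtain ⟨hc, hd, h1, h2⟩ : 0 < b 2 ∧ b 2 < b 3 ∧ 2 * b 1 ^ 2 < 3 * b 0 * b 2 ∧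
      6 * b 0 * b 3 + 4 * b 1 ^ 2 + b 2 ^ 2 <
          6 * b 0 * b 2 + 2 * b 1 * b 2 + 2 * b 1 * b 3 := hb
    -- In terms of moments, `b 3 = M 0`, `b 2 = M 1`, `2 * b 1 = M 2`, `6 * b 0 = M 3`. Then `b 3 -
    -- b 2`, `p`, `q` are the moments of orders 0, 1, 2 of the measure weighted by `1 - s`.
    obtain ⟨p, hp⟩ : ∃ p, p = b 2 - 2 * b 1 := ⟨_, rfl⟩
    obtain ⟨q, hq⟩ : ∃ q, q = 2 * b 1 - 6 * b 0 := ⟨_, rfl⟩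
    have hpq : p ^ 2 < (b 3 - b 2) * q := by rw [hp, hq]; linarith
    have hq0 : 0 < q := pos_of_mul_pos_right (a := b 3 - b 2) (by nlinarith [sq_nonneg p])
      (by linarith)
    have hb0 : 0 < b 0 := pos_of_mul_pos_left (b := b 2) (by nlinarith [sq_nonneg (b 1)]) hc.le
    have hb1 : 0 < b 1 := by linarith
    have hpq' : 0 < p - q := by
      rw [hp, hq]
      -- Here `p - q = M 1 - 2 * M 2 + M 3`, positive because `M 2 ^ 2 < M 1 * M 3 ≤ ((M 1 + M 3) /
      -- 2) ^ 2`.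
      nlinarith [sq_nonneg (b 2 - 6 * b 0)]
    have hp0 : 0 < p := by linarith
    have e1 : b 1 = (b 2 - p) / 2 := by linarith
    have e0 : b 0 = (b 2 - p - q) / 6 := by linarith
    -- Masses at `s = 0`, `q / p`, `1`. The first two come from the two-point solution for the
    -- weighted measure, divided by `1 - s`; the mass at `s = 1`, invisible to the weight, corrects
    -- `M 1`. It is nonnegative because `M 1 * (p - q) - p ^ 2 = M 1 * M 3 - M 2 ^ 2`.
    refine ⟨![(b 3 - b 2) - p ^ 2 / q, p ^ 3 / (q * (p - q)), b 2 - p ^ 2 / (p - q)],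
      ![1, 1 - q / p, 0], fun i => ?_, ?_⟩
    · fin_cases i
      · refine ⟨?_, by simp⟩
        simp only [Fin.zero_eta, Matrix.cons_val_zero]
        rw [sub_nonneg, div_le_iff₀ hq0]; linarith
      · simp only [Fin.mk_one, Matrix.cons_val_one]
        refine ⟨div_nonneg (pow_pos hp0 3).le (mul_pos hq0 hpq').le, ?_, ?_⟩
        · simp only [Matrix.cons_val_zero]
          rw [sub_nonneg, div_le_one hp0]; linarith
        · simp only [Matrix.cons_val_zero]
          rw [sub_le_self_iff]; positivity
      · refine ⟨?_, by simp⟩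
        simp only [Fin.reduceFinMk, Matrix.cons_val]
        rw [sub_nonneg, div_le_iff₀ hpq']
        nlinarith
    · ext j
      have := hpq'.ne'
      fin_cases j <;> simp [diracMoments, taylorKernel, Fin.sum_univ_succ, Nat.factorial, e0, e1] <;>
        field_simp <;> ring

end EndpointValues

theorem theoremt :
    (∀ n : ℕ, n ≤ 3 → EndpointValues.P n ∧ EndpointValues.W n = EndpointValues.WInf n) ∧
    EndpointValues.W 0 = {v : Fin 1 → ℝ | 0 < v 0} ∧
    EndpointValues.W 1 = {v : Fin 2 → ℝ | 0 < v 0 ∧ v 0 < v 1} ∧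
    EndpointValues.W 2 =
      {v : Fin 3 → ℝ | 0 < 2 * v 0 ∧ 2 * v 0 < v 1 ∧ v 1 ^ 2 < 2 * v 0 * v 2} ∧
    EndpointValues.W 3 =
      {v : Fin 4 → ℝ | 0 < v 2 ∧ v 2 < v 3 ∧ 2 * v 1 ^ 2 < 3 * v 0 * v 2 ∧
        6 * v 0 * v 3 + 4 * v 1 ^ 2 + v 2 ^ 2 <
          6 * v 0 * v 2 + 2 * v 1 * v 2 + 2 * v 1 * v 3} := by
  obtain ⟨p0, w0, e0⟩ := EndpointValues.explicit_zero
  obtain ⟨p1, w1, e1⟩ := EndpointValues.explicit_one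
  obtain ⟨p2, w2, e2⟩ := EndpointValues.explicit_two
  obtain ⟨p3, w3, e3⟩ := EndpointValues.explicit_three
  refine ⟨fun n hn => ?_, e0, e1, e2, e3⟩
  interval_cases n
  exacts [⟨p0, w0⟩, ⟨p1, w1⟩, ⟨p2, w2⟩, ⟨p3, w3⟩]
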